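/- Let $b>0$ and let $p,q>1$ satisfy $\frac1p+\frac1q=1$. For integrable $f,g$ on $[0,b]$ with integrable product let $$\mathcal T(f,g)=\frac1b\int_0^b f(t)g(t)\,dt-\Big(\frac1b\int_0^b f(t)\,dt\Big)\Big(\frac1b\int_0^b g(t)\,dt\Big)$$ be the Chebyshev functional. Let $\Phi_0:[0,b]\to(0,\infty)$ be convex on $[0,b]$ with $\Phi_0'\in L^p[0,b]$ (the derivative exists at all but countably many points). Then $\Phi_0$ and $\Phi_0^2$ are integrable on $[0,b]$ and $$\left|\mathcal T(\Phi_0,\Phi_0)\right|\le b\,\frac{pq\,\sin(\pi/p)\,\sin(\pi/q)}{4\pi^2\,(p-1)^{1/p}(q-1)^{1/q}}\;\|\Phi_0'\|_p\,\|\Phi_0'\|_q ,$$ where $\|\cdot\|_r$ is the $L^r[0,b]$ norm, with value $+\infty$ for functions that are not in $L^r$ (so that the right-hand side is $+\infty$ if $\Phi_0'\notin L^q[0,b]$). In particular, if $\Phi_0(x)=\frac1x\int_0^x\phi(t)\,dt$ for $0<x<b$, with $\phi:[0,b]\to[0,\infty)$ integrable, then the Hardy functional $$\frac1b\int_0^b\Big(\frac1x\int_0^x\phi(t)\,dt\Big)^2dx-\Big(\frac1b\int_0^b\Big(\frac1x\int_0^x\phi(t)\,dt\Big)dx\Big)^2$$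 is bounded in absolute value by the same right-hand side. -/

import Mathlib

open MeasureTheory

noncomputable section

/-- The Chebyshev functional `T(f, g)` on `[a, b]`. -/
def chebyshevFunctional (a b : ℝ) (f g : ℝ → ℝ) : ℝ :=
  1 / (b - a) * (∫ t in a..b, f t * g t)
    - (1 / (b - a) * ∫ t in a..b, f t) * (1 / (b - a) * ∫ t in a..b, g t)

/-- The Hardy average `x ↦ (1 / x) ∫₀ˣ φ(t) dt` (only used for `x > 0`). -/
def hardyAverage (φ : ℝ → ℝ) (x : ℝ) : ℝ :=
  1 / x * ∫ t in (0 : ℝ)..x, φ t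

/-- The Hardy functional of `φ` on `[0, b]`. -/
def hardyFunctional (b : ℝ) (φ : ℝ → ℝ) : ℝ :=
  1 / b * (∫ x in (0 : ℝ)..b, hardyAverage φ x ^ 2)
    - (1 / b * ∫ x in (0 : ℝ)..b, hardyAverage φ x) ^ 2

/-- The `L^p` norm on `[0, b]` of the derivative of `f`, with value `∞` when the derivative is not
in `L^p`. For convex `f` the derivative exists at all but countably many points of `(0, b)`, and
it does not depend on the values of `f` outside `[0, b]`. -/
def derivNorm (b p : ℝ) (f : ℝ → ℝ) : ENNReal :=
  eLpNorm (deriv f) (ENNReal.ofReal p) (volume.restrict (Set.Icc 0 b))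

/-- The constant
`b * p q sin(π/p) sin(π/q) / (4 π² (p-1)^(1/p) (q-1)^(1/q))`. -/
def hardyConst (b p q : ℝ) : ℝ :=
  b * (p * q * Real.sin (Real.pi / p) * Real.sin (Real.pi / q) /
    (4 * Real.pi ^ 2 * (p - 1) ^ (1 / p) * (q - 1) ^ (1 / q)))

end

/-! `chebyshevFunctional 0 b f f` is a variance, hence at most the mean of `(f - c) ^ 2` for any
constant `c`. Take `c = f (b / 2)` and split that mean by Hölder into the `L^p` and `L^q` norms of
`f - c`. Each norm is controlled by the Poincaré inequality on the two half-intervals, where `f - c`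
vanishes at the midpoint and is free at the outer end (`ConvexOn.lintegral_sub_midpoint_le`).

The Poincaré inequality is a Riccati argument (`poincare_of_generalizedTangent`): if `w' = -(p - 1)
* (r ^ p + w ^ q)`, Young's inequality bounds the derivative of `w * |u| ^ p` by `|u'| ^ p - (p - 1)
* r ^ p * |u| ^ p`. Such a `w` comes from `T' = 1 + T ^ q`, which lives up to `∫ 1 / (1 + r ^ q) = π
/ (q sin (π / q))`; this lifetime fixes the constant. Convexity supplies the regularity: one-sided
derivatives everywhere, monotone and locally bounded. -/

/-! ### Blow-up time of the generalized tangent -/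

/-- The integral of `1 / (1 + r ^ q)` over the positive half-line. -/
theorem lintegral_Ioi_inv_one_add_rpow {q : ℝ} (hq : 1 < q) :
    ∫⁻ r in Set.Ioi (0 : ℝ), ENNReal.ofReal ((1 + r ^ q)⁻¹) =
      ENNReal.ofReal (Real.pi / (q * Real.sin (Real.pi / q))) := by
  have hq0 : 0 < q := by linarith
  have hq1 : 1 / q < 1 := by rw [div_lt_one hq0]; exact hq
  -- A Laplace transform in `t`; after Tonelli both integrals are Gamma integrals, and the
  -- reflection formula closes.
  have h1 : ∀ r ∈ Set.Ioi (0 : ℝ), ENNReal.ofReal ((1 + r ^ q)⁻¹) =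
      ∫⁻ t in Set.Ioi (0 : ℝ), ENNReal.ofReal (Real.exp (-(1 + r ^ q) * t)) := by
    intro r hr
    have hpos : 0 < 1 + r ^ q := by have := Real.rpow_pos_of_pos hr q; linarith
    rw [← ofReal_integral_eq_lintegral_ofReal]
    · rw [integral_exp_mul_Ioi (by linarith)]
      rw [mul_zero, Real.exp_zero, neg_div_neg_eq, one_div]
    · exact integrableOn_exp_mul_Ioi (by linarith) 0
    · exact Filter.Eventually.of_forall fun _ => (Real.exp_pos _).le
  rw [setLIntegral_congr_fun measurableSet_Ioi h1, lintegral_lintegral_swap (by fun_prop)]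
  have h2 : ∀ t ∈ Set.Ioi (0 : ℝ),
      ∫⁻ r in Set.Ioi (0 : ℝ), ENNReal.ofReal (Real.exp (-(1 + r ^ q) * t)) =
      ENNReal.ofReal (Real.Gamma (1 / q + 1) * (Real.exp (-t) * t ^ ((1 - 1 / q) - 1))) := by
    intro t ht
    have hi : IntegrableOn (fun r : ℝ => Real.exp (-t * r ^ q)) (Set.Ioi 0) :=
      by simpa using integrableOn_rpow_mul_exp_neg_mul_rpow (s := 0) (by norm_num) hq0 ht
    have he : ∀ r : ℝ, Real.exp (-(1 + r ^ q) * t) = Real.exp (-t) * Real.exp (-t * r ^ q) := by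
      intro r; rw [← Real.exp_add]; congr 1; ring
    simp_rw [he]
    rw [← ofReal_integral_eq_lintegral_ofReal (hi.const_mul _)
      (Filter.Eventually.of_forall fun _ => by positivity), integral_const_mul,
      integral_exp_neg_mul_rpow hq0 ht]
    congr 1
    rw [show (1 - 1 / q) - 1 = -1 / q by ring]
    ring
  rw [setLIntegral_congr_fun measurableSet_Ioi h2, ← ofReal_integral_eq_lintegral_ofReal]
  · rw [integral_const_mul, ← Real.Gamma_eq_integral (by linarith),
      Real.Gamma_add_one (by positivity), mul_assoc, Real.Gamma_mul_Gamma_one_sub]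
    congr 1
    rw [mul_one_div]
    field_simp
  · exact (Real.GammaIntegral_convergent (by linarith)).const_mul _
  · refine (ae_restrict_mem measurableSet_Ioi).mono fun t ht => ?_
    have := Real.Gamma_pos_of_pos (s := 1 / q + 1) (by positivity)
    have := Real.rpow_pos_of_pos ht (1 - 1 / q - 1)
    simp only [Pi.zero_apply]
    positivity

theorem sin_pi_div_pos {p : ℝ} (hp : 1 < p) : 0 < Real.sin (Real.pi / p) := by
  apply Real.sin_pos_of_pos_of_lt_pi
  · have := Real.pi_pos; positivity
  · exact div_lt_self Real.pi_pos hp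

theorem integrableOn_Ioi_inv_one_add_rpow {q : ℝ} (hq : 1 < q) :
    IntegrableOn (fun r : ℝ => (1 + r ^ q)⁻¹) (Set.Ioi 0) := by
  refine ⟨by fun_prop, ?_⟩
  rw [hasFiniteIntegral_iff_ofReal, lintegral_Ioi_inv_one_add_rpow hq]
  · exact ENNReal.ofReal_lt_top
  · refine (ae_restrict_mem measurableSet_Ioi).mono fun t ht => ?_
    have := Real.rpow_pos_of_pos ht q
    simp only [Pi.zero_apply]
    positivity

theorem integral_Ioi_inv_one_add_rpow {q : ℝ} (hq : 1 < q) :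
    ∫ r in Set.Ioi (0 : ℝ), (1 + r ^ q)⁻¹ = Real.pi / (q * Real.sin (Real.pi / q)) := by
  rw [integral_eq_lintegral_of_nonneg_ae _ (integrableOn_Ioi_inv_one_add_rpow hq).1,
    lintegral_Ioi_inv_one_add_rpow hq, ENNReal.toReal_ofReal]
  · have := sin_pi_div_pos hq
    have := Real.pi_pos
    positivity
  · refine (ae_restrict_mem measurableSet_Ioi).mono fun t ht => ?_
    have := Real.rpow_pos_of_pos ht q
    simp only [Pi.zero_apply]
    positivity

/-! ### The equation `T' = 1 + T ^ q` -/

/-- A continuous function with a positive lower bound has an antiderivative that is an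
order isomorphism of the line, whose inverse solves an autonomous differential equation. -/
theorem exists_hasDerivAt_inv_comp {g : ℝ → ℝ} (hg : Continuous g) {c : ℝ} (hc : 0 < c)
    (hgc : ∀ r, c ≤ g r) :
    ∃ e : ℝ ≃o ℝ, (∀ s, e s = ∫ r in (0 : ℝ)..s, g r) ∧
      ∀ y, HasDerivAt e.symm (g (e.symm y))⁻¹ y := by
  set G : ℝ → ℝ := fun s => ∫ r in (0 : ℝ)..s, g r with hG
  have hd : ∀ s, HasDerivAt G (g s) s := fun s =>
    intervalIntegral.integral_hasDerivAt_right (hg.intervalIntegrable _ _)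
      (hg.stronglyMeasurableAtFilter _ _) hg.continuousAt
  have hGc : Continuous G := continuous_iff_continuousAt.2 fun s => (hd s).continuousAt
  have hmono : StrictMono G := strictMono_of_hasDerivAt_pos hd fun s => hc.trans_le (hgc s)
  -- Growth at least linear with slope `c` forces surjectivity at both ends.
  have hm2 : Monotone fun s => G s - c * s :=
    monotone_of_hasDerivAt_nonneg (f' := fun s => g s - c)
      (fun s => by simpa using! (hd s).sub ((hasDerivAt_id s).const_mul c))
      (fun s => sub_nonneg.2 (hgc s))
  have hG0 : G 0 = 0 := by simp [hG]
  have hsurj : Function.Surjective G := by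
    apply hGc.surjective
    · refine Filter.tendsto_atTop_mono' _ ?_ (Filter.tendsto_id.const_mul_atTop hc)
      filter_upwards [Filter.eventually_ge_atTop 0] with s hs
      have := hm2 hs
      simp only [hG0, id] at *
      linarith
    · refine Filter.tendsto_atBot_mono' _ ?_ (Filter.tendsto_id.const_mul_atBot hc)
      filter_upwards [Filter.eventually_le_atBot 0] with s hs
      have := hm2 hs
      simp only [hG0, id] at *
      linarith
  refine ⟨hmono.orderIsoOfSurjective G hsurj, fun s => rfl, fun y => ?_⟩
  refine HasDerivAt.of_local_left_inverse (f := G)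
    (OrderIso.continuous _).continuousAt (hd _) (hc.trans_le (hgc _)).ne' ?_
  exact Filter.Eventually.of_forall fun z =>
    (hmono.orderIsoOfSurjective G hsurj).apply_symm_apply z

/-- A solution of `T' = 1 + T ^ q`, `T 0 = 0`, on a compact part of its maximal interval. -/
theorem exists_generalizedTangent {q Y : ℝ} (hq : 1 < q)
    (hY : Y < Real.pi / (q * Real.sin (Real.pi / q))) :
    ∃ T : ℝ → ℝ, T 0 = 0 ∧ Continuous T ∧ ∀ y ∈ Set.Icc 0 Y,
      0 ≤ T y ∧ HasDerivAt T (1 + T y ^ q) y := by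
  have hq0 : 0 < q := by linarith
  have hlim := intervalIntegral_tendsto_integral_Ioi 0
    (integrableOn_Ioi_inv_one_add_rpow hq) Filter.tendsto_id
  rw [integral_Ioi_inv_one_add_rpow hq] at hlim
  obtain ⟨s, hYs, hs⟩ :=
    ((hlim.eventually (lt_mem_nhds hY)).and (Filter.eventually_ge_atTop 0)).exists
  simp only [id] at hYs
  -- Clamping to `[0, s]` keeps the integrand bounded below without changing it where `T` takes its
  -- values.
  set cl : ℝ → ℝ := fun r => max 0 (min r s) with hcl
  have hcl0 : ∀ r, 0 ≤ cl r := fun r => le_max_left _ _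
  have hcls : ∀ r, cl r ≤ s := fun r => max_le hs (min_le_right _ _)
  have hclid : ∀ r ∈ Set.Icc 0 s, cl r = r := by
    intro r hr
    simp [hcl, hr.1, hr.2]
  have hg : Continuous fun r => (1 + cl r ^ q)⁻¹ := by
    have h : Continuous fun r => cl r ^ q :=
      (by fun_prop : Continuous cl).rpow_const fun _ => Or.inr hq0.le
    refine (continuous_const.add h).inv₀ fun r => ?_
    have := Real.rpow_nonneg (hcl0 r) q
    exact (add_pos_of_pos_of_nonneg one_pos this).ne'
  have hsq := Real.rpow_nonneg hs q
  obtain ⟨e, he, hd⟩ := exists_hasDerivAt_inv_comp hg (c := (1 + s ^ q)⁻¹) (by positivity) (by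
    intro r
    have h0 := Real.rpow_nonneg (hcl0 r) q
    have := Real.rpow_le_rpow (hcl0 r) (hcls r) hq0.le
    exact inv_anti₀ (by positivity) (by linarith))
  have he0 : e.symm 0 = 0 := by
    rw [OrderIso.symm_apply_eq, he]; simp
  have hes : Y < e s := by
    rw [he]
    refine hYs.trans_eq (intervalIntegral.integral_congr fun r hr => ?_)
    rw [Set.uIcc_of_le hs] at hr
    simp only [hclid r hr]
  refine ⟨e.symm, he0, e.symm.continuous, fun y hy => ?_⟩
  have h0 : 0 ≤ e.symm y := by
    rw [← he0]; exact e.symm.monotone hy.1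
  have h1 : e.symm y ≤ s := by
    rw [OrderIso.symm_apply_le]; exact hy.2.trans hes.le
  refine ⟨h0, ?_⟩
  have := hd y
  simpa only [hclid _ ⟨h0, h1⟩, inv_inv] using this

/-! ### Riccati weight and the Poincaré inequality -/

/-- The first eigenvalue of the one-dimensional `p`-Laplacian on an interval of length `L`, with
mixed boundary conditions. -/
noncomputable def mixedEigenvalue (p L : ℝ) : ℝ :=
  (p - 1) * (Real.pi / (p * Real.sin (Real.pi / p) * L)) ^ p

theorem mixedEigenvalue_pos {p L : ℝ} (hp : 1 < p) (hL : 0 < L) : 0 < mixedEigenvalue p L := by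
  have := sin_pi_div_pos hp
  have := Real.pi_pos
  have : 0 < p - 1 := by linarith
  have : 0 < p := by linarith
  unfold mixedEigenvalue
  positivity

/-- The algebraic form of Young's inequality behind the Riccati argument. -/
theorem young_riccati {p q w a v : ℝ} (hpq : p.HolderConjugate q) (hw : 0 ≤ w) :
    w * (p * |a| ^ (p - 2) * a * v) ≤ |v| ^ p + (p - 1) * w ^ q * |a| ^ p := by
  have hp := hpq.lt
  have hp0 := hpq.pos
  have hq0 := hpq.symm.pos
  have h1 : |a| ^ (p - 2) * a ≤ |a| ^ (p - 1) ∧ -|a| ^ (p - 1) ≤ |a| ^ (p - 2) * a := by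
    rcases eq_or_ne a 0 with rfl | ha
    · simp [Real.zero_rpow (show p - 1 ≠ 0 by linarith)]
    · have hpos : 0 < |a| := abs_pos.2 ha
      have : |a| ^ (p - 1) = |a| ^ (p - 2) * |a| := by
        rw [← Real.rpow_add_one hpos.ne']; congr 1; ring
      have h0 := Real.rpow_nonneg hpos.le (p - 2)
      rw [this]
      constructor
      · exact mul_le_mul_of_nonneg_left (le_abs_self a) h0
      · rw [← mul_neg]; exact mul_le_mul_of_nonneg_left (neg_abs_le a) h0
  have h2 : |a| ^ (p - 2) * a * v ≤ |v| * |a| ^ (p - 1) := by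
    refine (le_abs_self _).trans ?_
    rw [abs_mul, mul_comm]
    exact mul_le_mul_of_nonneg_left (abs_le.2 ⟨h1.2, h1.1⟩) (abs_nonneg v)
  have h3 := Real.young_inequality_of_nonneg (abs_nonneg v)
    (mul_nonneg hw (Real.rpow_nonneg (abs_nonneg a) (p - 1))) hpq
  rw [Real.mul_rpow hw (by positivity), ← Real.rpow_mul (abs_nonneg a), hpq.sub_one_mul_conj] at h3
  have h4 : p / q = p - 1 := by
    rw [div_eq_iff hq0.ne', hpq.sub_one_mul_conj]
  calc w * (p * |a| ^ (p - 2) * a * v) = p * w * (|a| ^ (p - 2) * a * v) := by ring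
    _ ≤ p * w * (|v| * |a| ^ (p - 1)) := mul_le_mul_of_nonneg_left h2 (by positivity)
    _ = p * (|v| * (w * |a| ^ (p - 1))) := by ring
    _ ≤ p * (|v| ^ p / p + w ^ q * |a| ^ p / q) := mul_le_mul_of_nonneg_left h3 hp0.le
    _ = |v| ^ p + (p / q) * w ^ q * |a| ^ p := by field_simp
    _ = _ := by rw [h4]

/-- A solution `T` of `T' = 1 + T ^ q` yields a Poincaré inequality through the Riccati weight
`x ↦ r ^ (p - 1) * T ((p - 1) * r * (M - x))`. -/
theorem poincare_of_generalizedTangent {p q r M : ℝ} (hpq : p.HolderConjugate q) (hr : 0 < r)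
    (hM : 0 ≤ M) {T : ℝ → ℝ} (hT0 : T 0 = 0) (hTc : Continuous T)
    (hT : ∀ y ∈ Set.Icc 0 ((p - 1) * r * M), 0 ≤ T y ∧ HasDerivAt T (1 + T y ^ q) y)
    {u v : ℝ → ℝ} (hu : ContinuousOn u (Set.Icc 0 M)) (hu0 : u 0 = 0)
    (huv : ∀ x ∈ Set.Ioo 0 M, HasDerivWithinAt u (v x) (Set.Ioi x) x)
    (hv : IntegrableOn (fun x => |v x| ^ p) (Set.Icc 0 M)) :
    (p - 1) * r ^ p * ∫ x in (0 : ℝ)..M, |u x| ^ p ≤ ∫ x in (0 : ℝ)..M, |v x| ^ p := by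
  have hp := hpq.lt
  have hp0 := hpq.pos
  have hp1 : 0 < p - 1 := by linarith
  have hup : ContinuousOn (fun x => |u x| ^ p) (Set.Icc 0 M) :=
    hu.abs.rpow_const fun _ _ => Or.inr hp0.le
  have hui : IntegrableOn (fun x => |u x| ^ p) (Set.Icc 0 M) := hup.integrableOn_Icc
  have hmem : ∀ x ∈ Set.Icc 0 M, (p - 1) * r * (M - x) ∈ Set.Icc 0 ((p - 1) * r * M) := by
    intro x hx
    have : 0 ≤ M - x := by linarith [hx.2]
    refine ⟨by positivity, mul_le_mul_of_nonneg_left (by linarith [hx.1]) (by positivity)⟩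
  have hk : r ^ p = r ^ (p - 1) * r := by
    rw [← Real.rpow_add_one hr.ne']; congr 1; ring
  have hkq : (r ^ (p - 1)) ^ q = r ^ p := by
    rw [← Real.rpow_mul hr.le, hpq.sub_one_mul_conj]
  have hr1 : 0 ≤ r ^ (p - 1) := Real.rpow_nonneg hr.le _
  -- This form needs only a right derivative and an integrable upper bound for it. The boundary
  -- terms vanish: `u 0 = 0` on the left, `T 0 = 0` on the right.
  have key := intervalIntegral.sub_le_integral_of_hasDeriv_right_of_le hM
    (g := fun x => r ^ (p - 1) * T ((p - 1) * r * (M - x)) * |u x| ^ p)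
    (g' := fun x => r ^ (p - 1) * ((1 + T ((p - 1) * r * (M - x)) ^ q) * ((p - 1) * r * (-1)))
      * |u x| ^ p + r ^ (p - 1) * T ((p - 1) * r * (M - x)) * (p * |u x| ^ (p - 2) * u x * v x))
    (φ := fun x => |v x| ^ p - (p - 1) * r ^ p * |u x| ^ p) ?_ ?_ ?_ ?_
  · simp only [hu0, abs_zero, Real.zero_rpow hp0.ne', mul_zero, sub_self, hT0, zero_mul] at key
    rw [intervalIntegral.integral_sub, intervalIntegral.integral_const_mul] at key
    · linarith
    · exact (intervalIntegrable_iff_integrableOn_Icc_of_le hM).2 hv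
    · exact ((intervalIntegrable_iff_integrableOn_Icc_of_le hM).2 hui).const_mul _
  · exact ContinuousOn.mul (by fun_prop) hup
  · intro x hx
    have hTx := (hT _ (hmem x ⟨hx.1.le, hx.2.le⟩)).2
    have hlin : HasDerivAt (fun x => (p - 1) * r * (M - x)) ((p - 1) * r * (-1)) x :=
      ((hasDerivAt_id x).const_sub M).const_mul _
    have h1 := (hTx.comp x hlin).const_mul (r ^ (p - 1))
    have h2 := (hasDerivAt_abs_rpow (u x) hp).comp_hasDerivWithinAt x (huv x hx)
    exact h1.hasDerivWithinAt.mul h2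
  · exact hv.sub (hui.const_mul _)
  · intro x hx
    have hTx := (hT _ (hmem x ⟨hx.1.le, hx.2.le⟩)).1
    have h := young_riccati (a := u x) (v := v x) hpq (mul_nonneg hr1 hTx)
    rw [Real.mul_rpow hr1 hTx, hkq] at h
    simp only [hk] at h ⊢
    -- The two `T ^ q` terms cancel, since `(r ^ (p - 1)) ^ q = r ^ p`.
    nlinarith [h]

/-- Matches the lifetime of `T`, expressed in `q`, with the eigenvalue, expressed in `p`: the weight
exists on `[0, M]` exactly when `M < L`. The sines agree because `π / p + π / q = π`. -/
theorem pi_div_conj_eq {p q : ℝ} (hpq : p.HolderConjugate q) :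
    Real.pi / (q * Real.sin (Real.pi / q)) =
      (p - 1) * (Real.pi / (p * Real.sin (Real.pi / p))) := by
  have hs := sin_pi_div_pos hpq.lt
  have hp0 := hpq.pos
  have hp1 := hpq.sub_one_pos
  have h : Real.sin (Real.pi / q) = Real.sin (Real.pi / p) := by
    rw [← Real.sin_pi_sub, div_eq_mul_inv _ q, ← hpq.one_sub_inv]
    congr 1
    ring
  have hq0 := hpq.symm.pos
  rw [h]
  field_simp
  rw [mul_comm, hpq.sub_one_mul_conj]

/-- The sharp Poincaré inequality on `[0, M]`, `M < L`, for functions vanishing at `0`, with the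
constant of the interval `[0, L]`. -/
theorem poincare_of_hasDerivWithinAt {p q L M : ℝ} (hpq : p.HolderConjugate q) (hM : 0 ≤ M)
    (hML : M < L) {u v : ℝ → ℝ} (hu : ContinuousOn u (Set.Icc 0 M)) (hu0 : u 0 = 0)
    (huv : ∀ x ∈ Set.Ioo 0 M, HasDerivWithinAt u (v x) (Set.Ioi x) x)
    (hv : IntegrableOn (fun x => |v x| ^ p) (Set.Icc 0 M)) :
    mixedEigenvalue p L * ∫ x in (0 : ℝ)..M, |u x| ^ p ≤ ∫ x in (0 : ℝ)..M, |v x| ^ p := by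
  have hs := sin_pi_div_pos hpq.lt
  have hp0 := hpq.pos
  have hp1 := hpq.sub_one_pos
  have hpi := Real.pi_pos
  have hL : 0 < L := hM.trans_lt hML
  have hlt : (p - 1) * (Real.pi / (p * Real.sin (Real.pi / p) * L)) * M <
      Real.pi / (q * Real.sin (Real.pi / q)) := by
    rw [pi_div_conj_eq hpq]
    calc (p - 1) * (Real.pi / (p * Real.sin (Real.pi / p) * L)) * M
        = (p - 1) * (Real.pi / (p * Real.sin (Real.pi / p))) * (M / L) := by field_simp
      _ < (p - 1) * (Real.pi / (p * Real.sin (Real.pi / p))) * 1 := by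
          apply mul_lt_mul_of_pos_left _ (by positivity)
          rwa [div_lt_one hL]
      _ = _ := mul_one _
  obtain ⟨T, hT0, hTc, hT⟩ := exists_generalizedTangent hpq.symm.lt hlt
  exact poincare_of_generalizedTangent hpq (by positivity) hM hT0 hTc hT hu hu0 huv hv

/-! ### Poincaré inequality for convex functions -/

/-- A convex function on an open interval is almost everywhere differentiable there. -/
theorem ConvexOn.ae_differentiableAt_Icc {a b c d : ℝ} {u : ℝ → ℝ}
    (hu : ConvexOn ℝ (Set.Ioo a b) u) (hac : a < c) (hdb : d < b) :
    ∀ᵐ x ∂(volume.restrict (Set.Icc c d)), DifferentiableAt ℝ u x := by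
  have hsub : Set.Icc c d ⊆ Set.Ioo a b := fun x hx => ⟨hac.trans_le hx.1, hx.2.trans_lt hdb⟩
  have hlip : LocallyLipschitzOn (Set.Icc c d) u :=
    (hu.locallyLipschitzOn isOpen_Ioo).mono hsub
  obtain ⟨C, hC⟩ := hlip.exists_lipschitzOnWith_of_compact isCompact_Icc
  have h := hC.ae_differentiableWithinAt_real measurableSet_Icc
  rw [← restrict_Ioo_eq_restrict_Icc] at h ⊢
  filter_upwards [h, ae_restrict_mem measurableSet_Ioo] with x hx hxm
  exact hx.differentiableAt (Icc_mem_nhds hxm.1 hxm.2)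

theorem lintegral_enorm_rpow_Icc_eq {p M : ℝ} (hp : 0 ≤ p) (hM : 0 ≤ M) {f : ℝ → ℝ}
    (hf : IntegrableOn (fun x => |f x| ^ p) (Set.Icc 0 M)) :
    ∫⁻ x in Set.Icc 0 M, ‖f x‖ₑ ^ p = ENNReal.ofReal (∫ x in (0 : ℝ)..M, |f x| ^ p) := by
  rw [intervalIntegral.integral_of_le hM, ← integral_Icc_eq_integral_Ioc,
    ofReal_integral_eq_lintegral_ofReal hf (Filter.Eventually.of_forall fun x => by positivity)]
  refine lintegral_congr fun x => ?_
  rw [← ENNReal.ofReal_rpow_of_nonneg (abs_nonneg _) hp, Real.enorm_eq_ofReal_abs]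

/-- The sharp Poincaré inequality for convex functions on `(-L, L)` vanishing at `0`, on the
half-interval `(0, L)`. -/
theorem ConvexOn.lintegral_poincare {p q L : ℝ} (hpq : p.HolderConjugate q) (hL : 0 < L)
    {u : ℝ → ℝ} (hu : ConvexOn ℝ (Set.Ioo (-L) L) u) (hu0 : u 0 = 0) :
    ENNReal.ofReal (mixedEigenvalue p L) * ∫⁻ x in Set.Ioo 0 L, ‖u x‖ₑ ^ p ≤
      ∫⁻ x in Set.Ioo 0 L, ‖deriv u x‖ₑ ^ p := by
  have hp0 := hpq.pos
  have huc : ContinuousOn u (Set.Ioo (-L) L) := hu.continuousOn isOpen_Ioo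
  have hmain : ∀ M ∈ Set.Ioo 0 L,
      ENNReal.ofReal (mixedEigenvalue p L) * ∫⁻ x in Set.Icc 0 M, ‖u x‖ₑ ^ p ≤
        ∫⁻ x in Set.Ioo 0 L, ‖deriv u x‖ₑ ^ p := by
    intro M hM
    have hsub : Set.Icc 0 M ⊆ Set.Ioo (-L) L := fun x hx =>
      ⟨by linarith [hx.1], hx.2.trans_lt hM.2⟩
    set v : ℝ → ℝ := fun x => derivWithin u (Set.Ioi x) x with hv
    have hvm : MonotoneOn v (Set.Icc 0 M) := by
      have := hu.monotoneOn_rightDeriv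
      rw [interior_Ioo] at this
      exact this.mono hsub
    have huM : IntegrableOn (fun x => |u x| ^ p) (Set.Icc 0 M) :=
      (((huc.mono hsub).abs).rpow_const fun _ _ => Or.inr hp0.le).integrableOn_Icc
    -- Both `0` and `M` are interior to `(-L, L)`, so the monotone right derivative is bounded by
    -- its values there.
    have hvM : IntegrableOn (fun x => |v x| ^ p) (Set.Icc 0 M) := by
      have hvi : AEStronglyMeasurable v (volume.restrict (Set.Icc 0 M)) :=
        (hvm.integrableOn_isCompact isCompact_Icc).1
      have hmeas : AEStronglyMeasurable (fun x => |v x| ^ p) (volume.restrict (Set.Icc 0 M)) := by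
        have := hvi.aemeasurable
        exact (by fun_prop : AEMeasurable (fun x => |v x| ^ p) _).aestronglyMeasurable
      refine Integrable.of_bound hmeas ((max |v 0| |v M|) ^ p) ?_
      filter_upwards [ae_restrict_mem measurableSet_Icc] with x hx
      rw [Real.norm_of_nonneg (by positivity)]
      refine Real.rpow_le_rpow (abs_nonneg _) ?_ hp0.le
      exact abs_le_max_abs_abs (hvm ⟨le_rfl, hM.1.le⟩ hx hx.1) (hvm hx ⟨hM.1.le, le_rfl⟩ hx.2)
    have h := poincare_of_hasDerivWithinAt hpq hM.1.le hM.2 (huc.mono hsub) hu0 (v := v)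
      (fun x hx => hu.hasDerivWithinAt_rightDeriv_of_mem_interior (by
        rw [interior_Ioo]; exact hsub ⟨hx.1.le, hx.2.le⟩)) hvM
    calc _ = ENNReal.ofReal (mixedEigenvalue p L * ∫ x in (0 : ℝ)..M, |u x| ^ p) := by
          rw [lintegral_enorm_rpow_Icc_eq hp0.le hM.1.le huM,
            ENNReal.ofReal_mul (mixedEigenvalue_pos hpq.lt hL).le]
      _ ≤ ENNReal.ofReal (∫ x in (0 : ℝ)..M, |v x| ^ p) := ENNReal.ofReal_le_ofReal h
      _ = ∫⁻ x in Set.Icc 0 M, ‖v x‖ₑ ^ p :=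
          (lintegral_enorm_rpow_Icc_eq hp0.le hM.1.le hvM).symm
      _ = ∫⁻ x in Set.Icc 0 M, ‖deriv u x‖ₑ ^ p := by
          refine lintegral_congr_ae ?_
          filter_upwards [hu.ae_differentiableAt_Icc (neg_lt_zero.2 hL) hM.2] with x hx
          simp only [hv, hx.derivWithin (uniqueDiffWithinAt_Ioi x)]
      _ = ∫⁻ x in Set.Ioo 0 M, ‖deriv u x‖ₑ ^ p := by rw [restrict_Ioo_eq_restrict_Icc]
      _ ≤ _ := lintegral_mono_set (Set.Ioo_subset_Ioo_right hM.2.le)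
  -- Let `M` increase to `L`; no integrability up to `L` is needed in `ENNReal`.
  have hcover : AECover (volume.restrict (Set.Ioo 0 L)) (nhdsWithin L (Set.Iio L))
      fun M => Set.Icc (0 : ℝ) M :=
    aecover_Ioo_of_Icc tendsto_const_nhds (tendsto_nhdsWithin_of_tendsto_nhds Filter.tendsto_id)
  have hmeas : AEMeasurable (fun x => ‖u x‖ₑ ^ p) (volume.restrict (Set.Ioo 0 L)) := by
    have : AEMeasurable u (volume.restrict (Set.Ioo 0 L)) :=
      (huc.mono (Set.Ioo_subset_Ioo_left (by linarith))).aemeasurable measurableSet_Ioo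
    fun_prop
  have hlim := hcover.lintegral_tendsto_of_countably_generated hmeas
  refine le_of_tendsto (ENNReal.Tendsto.const_mul hlim (Or.inr ENNReal.ofReal_ne_top)) ?_
  filter_upwards [Ioo_mem_nhdsLT hL] with M hM
  refine le_trans ?_ (hmain M hM)
  gcongr
  exact Measure.restrict_le_self

/-- The sharp Poincaré inequality for a convex function on `(0, b)`, centred at its value at the
midpoint. -/
theorem ConvexOn.lintegral_sub_midpoint_le {p q b : ℝ} (hpq : p.HolderConjugate q) (hb : 0 < b)
    {f : ℝ → ℝ} (hf : ConvexOn ℝ (Set.Ioo 0 b) f) :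
    ENNReal.ofReal (mixedEigenvalue p (b / 2)) * ∫⁻ x in Set.Ioo 0 b, ‖f x - f (b / 2)‖ₑ ^ p ≤
      ∫⁻ x in Set.Ioo 0 b, ‖deriv f x‖ₑ ^ p := by
  have hb2 : 0 < b / 2 := by linarith
  have hR : ConvexOn ℝ (Set.Ioo (-(b / 2)) (b / 2)) fun x => f (b / 2 + x) - f (b / 2) := by
    refine ConvexOn.sub ?_ (concaveOn_const _ (convex_Ioo _ _))
    have := hf.translate_right (b / 2)
    refine this.subset (fun x hx => ?_) (convex_Ioo _ _)
    constructor <;> linarith [hx.1, hx.2]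
  have hLft : ConvexOn ℝ (Set.Ioo (-(b / 2)) (b / 2)) fun x => f (b / 2 - x) - f (b / 2) := by
    refine ConvexOn.sub ?_ (concaveOn_const _ (convex_Ioo _ _))
    have := hf.comp_affineMap (AffineMap.const ℝ ℝ (b / 2) - AffineMap.id ℝ ℝ)
    refine this.subset (fun x hx => ?_) (convex_Ioo _ _)
    simp only [Set.mem_preimage, AffineMap.coe_sub, AffineMap.coe_const, AffineMap.coe_id,
      Pi.sub_apply, Function.const_apply, id]
    constructor <;> linarith [hx.1, hx.2]
  have h1 := hR.lintegral_poincare hpq hb2 (by simp)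
  have h2 := hLft.lintegral_poincare hpq hb2 (by simp)
  simp only [deriv_sub_const_fun, deriv_comp_const_add, deriv_comp_const_sub, enorm_neg] at h1 h2
  have e1 : ∀ g : ℝ → ENNReal, ∫⁻ x in Set.Ioo 0 (b / 2), g (b / 2 + x) =
      ∫⁻ x in Set.Ioo (b / 2) b, g x := by
    intro g
    have := (measurePreserving_add_left volume (b / 2)).setLIntegral_comp_preimage_emb
      (measurableEmbedding_addLeft (b / 2)) g (Set.Ioo (b / 2) b)
    rw [← this]
    congr 2
    ext x
    simp only [Set.mem_Ioo, Set.mem_preimage]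
    constructor <;> rintro ⟨h, h'⟩ <;> constructor <;> linarith
  have e2 : ∀ g : ℝ → ENNReal, ∫⁻ x in Set.Ioo 0 (b / 2), g (b / 2 - x) =
      ∫⁻ x in Set.Ioo 0 (b / 2), g x := by
    intro g
    have := (volume.measurePreserving_sub_left (b / 2)).setLIntegral_comp_preimage_emb
      (Homeomorph.subLeft (b / 2)).measurableEmbedding g (Set.Ioo 0 (b / 2))
    rw [← this]
    congr 2
    ext x
    simp only [Set.mem_Ioo, Set.mem_preimage]
    constructor <;> rintro ⟨h, h'⟩ <;> constructor <;> linarith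
  have e3 : ∀ g : ℝ → ENNReal, ∫⁻ x in Set.Ioo 0 b, g x =
      (∫⁻ x in Set.Ioo 0 (b / 2), g x) + ∫⁻ x in Set.Ioo (b / 2) b, g x := by
    intro g
    rw [restrict_Ioo_eq_restrict_Ioc, restrict_Ioo_eq_restrict_Ioc, restrict_Ioo_eq_restrict_Ioc,
      ← Set.Ioc_union_Ioc_eq_Ioc hb2.le (by linarith : b / 2 ≤ b),
      lintegral_union measurableSet_Ioc]
    exact Set.Ioc_disjoint_Ioc_of_le le_rfl
  rw [e1 fun x => ‖f x - f (b / 2)‖ₑ ^ p, e1 fun x => ‖deriv f x‖ₑ ^ p] at h1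
  rw [e2 fun x => ‖f x - f (b / 2)‖ₑ ^ p, e2 fun x => ‖deriv f x‖ₑ ^ p] at h2
  rw [e3, e3, mul_add]
  exact add_le_add h2 h1

/-! ### Constants, variance and Hölder -/

theorem mixedEigenvalue_rpow {p b : ℝ} (hp : 1 < p) (hb : 0 < b) :
    (mixedEigenvalue p b) ^ (1 / p) =
      (p - 1) ^ (1 / p) * (Real.pi / (p * Real.sin (Real.pi / p) * b)) := by
  have := sin_pi_div_pos hp
  have := Real.pi_pos
  have hp1 : 0 < p - 1 := by linarith
  have : 0 < p := by linarith
  rw [mixedEigenvalue, Real.mul_rpow hp1.le (by positivity), ← Real.rpow_mul (by positivity),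
    mul_one_div_cancel (by positivity), Real.rpow_one]

/-- The constant is the averaging factor times the two Poincaré constants on half-length `b / 2`. -/
theorem hardyConst_eq {b p q : ℝ} (hb : 0 < b) (hp : 1 < p) (hq : 1 < q) :
    hardyConst b p q = 1 / b * ((mixedEigenvalue p (b / 2)) ^ (1 / p))⁻¹ *
      ((mixedEigenvalue q (b / 2)) ^ (1 / q))⁻¹ := by
  rw [mixedEigenvalue_rpow hp (by linarith), mixedEigenvalue_rpow hq (by linarith), hardyConst]
  have := sin_pi_div_pos hp
  have := sin_pi_div_pos hq
  have := Real.pi_pos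
  have hp1 : 0 < p - 1 := by linarith
  have hq1 : 0 < q - 1 := by linarith
  have := Real.rpow_pos_of_pos hp1 (1 / p)
  have := Real.rpow_pos_of_pos hq1 (1 / q)
  have : 0 < p := by linarith
  have : 0 < q := by linarith
  field_simp
  ring

theorem derivNorm_eq {b p : ℝ} (hp : 0 < p) (f : ℝ → ℝ) :
    derivNorm b p f = (∫⁻ x in Set.Ioo 0 b, ‖deriv f x‖ₑ ^ p) ^ (1 / p) := by
  rw [derivNorm, eLpNorm_eq_lintegral_rpow_enorm_toReal (by simpa using hp) (by simp),
    ENNReal.toReal_ofReal hp.le, restrict_Ioo_eq_restrict_Icc]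

theorem ENNReal.rpow_inv_le_of_ofReal_mul_le {a p : ℝ} (ha : 0 < a) (hp : 0 < p)
    {x y : ENNReal} (h : ENNReal.ofReal a * x ≤ y) :
    x ^ (1 / p) ≤ ENNReal.ofReal (a ^ (1 / p))⁻¹ * y ^ (1 / p) := by
  have h1 : x ≤ ENNReal.ofReal a⁻¹ * y := by
    calc x = ENNReal.ofReal a⁻¹ * (ENNReal.ofReal a * x) := by
          rw [← mul_assoc, ← ENNReal.ofReal_mul (by positivity), inv_mul_cancel₀ ha.ne']
          simp
      _ ≤ _ := by gcongr
  calc x ^ (1 / p) ≤ (ENNReal.ofReal a⁻¹ * y) ^ (1 / p) :=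
        ENNReal.rpow_le_rpow h1 (by positivity)
    _ = _ := by
      rw [ENNReal.mul_rpow_of_nonneg _ _ (by positivity),
        ENNReal.ofReal_rpow_of_nonneg (by positivity) (by positivity), Real.inv_rpow ha.le]

/-- The Chebyshev functional of `(f, f)` is bounded by the mean square distance to a constant. -/
theorem abs_chebyshevFunctional_self_le {b : ℝ} (hb : 0 < b) {f : ℝ → ℝ}
    (hf : IntervalIntegrable f volume 0 b)
    (hff : IntervalIntegrable (fun t => f t * f t) volume 0 b) (c : ℝ) :
    |chebyshevFunctional 0 b f f| ≤
      1 / b * ∫ t in (0 : ℝ)..b, (f t - c) * (f t - c) := by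
  set I := ∫ t in (0 : ℝ)..b, f t with hI
  set J := ∫ t in (0 : ℝ)..b, f t * f t with hJ
  have hexp : ∀ d : ℝ, ∫ t in (0 : ℝ)..b, (f t - d) * (f t - d) = J - 2 * d * I + b * d ^ 2 := by
    intro d
    have : ∀ t, (f t - d) * (f t - d) = f t * f t - 2 * d * f t + d ^ 2 := fun t => by ring
    simp_rw [this]
    rw [intervalIntegral.integral_add (hff.sub (hf.const_mul _)) (by simp),
      intervalIntegral.integral_sub hff (hf.const_mul _), intervalIntegral.integral_const_mul]
    simp [hI, hJ]
  have hT : chebyshevFunctional 0 b f f = 1 / b * J - (1 / b * I) ^ 2 := by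
    simp only [chebyshevFunctional, sub_zero, ← hI, ← hJ]; ring
  -- The choice `d = I / b`, the mean, makes this `b` times the variance.
  have h0 : 0 ≤ J - 2 * (I / b) * I + b * (I / b) ^ 2 := by
    rw [← hexp]
    exact intervalIntegral.integral_nonneg hb.le fun t _ => mul_self_nonneg _
  have hT' : chebyshevFunctional 0 b f f = 1 / b * (J - 2 * (I / b) * I + b * (I / b) ^ 2) := by
    rw [hT]; field_simp; ring
  rw [abs_of_nonneg (by rw [hT']; positivity), hexp, hT]
  have : 1 / b * (J - 2 * c * I + b * c ^ 2) - (1 / b * J - (1 / b * I) ^ 2) = (c - I / b) ^ 2 := by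
    field_simp; ring
  nlinarith [sq_nonneg (c - I / b)]

/-- A positive convex function on a compact interval is integrable together with its square. -/
theorem ConvexOn.intervalIntegrable_of_pos {b : ℝ} (hb : 0 < b) {f : ℝ → ℝ}
    (hpos : ∀ x ∈ Set.Icc 0 b, 0 < f x) (hf : ConvexOn ℝ (Set.Icc 0 b) f) :
    IntervalIntegrable f volume 0 b ∧ IntervalIntegrable (fun t => f t * f t) volume 0 b := by
  have hbd : ∀ x ∈ Set.Ioo 0 b, ‖f x‖ ≤ max (f 0) (f b) := by
    intro x hx
    have hxm : x ∈ Set.Icc 0 b := ⟨hx.1.le, hx.2.le⟩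
    rw [Real.norm_of_nonneg (hpos x hxm).le]
    exact hf.le_max_of_mem_Icc ⟨le_rfl, hb.le⟩ ⟨hb.le, le_rfl⟩ hxm
  have hcont : ContinuousOn f (Set.Ioo 0 b) :=
    (hf.subset Set.Ioo_subset_Icc_self (convex_Ioo _ _)).continuousOn isOpen_Ioo
  have hm : AEStronglyMeasurable f (volume.restrict (Set.Ioo 0 b)) :=
    hcont.aestronglyMeasurable measurableSet_Ioo
  rw [intervalIntegrable_iff_integrableOn_Ioo_of_le hb.le,
    intervalIntegrable_iff_integrableOn_Ioo_of_le hb.le]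
  refine ⟨Integrable.of_bound hm (max (f 0) (f b)) ?_,
    Integrable.of_bound (hm.mul hm) (max (f 0) (f b) * max (f 0) (f b)) ?_⟩
  · filter_upwards [ae_restrict_mem measurableSet_Ioo] with x hx using hbd x hx
  · filter_upwards [ae_restrict_mem measurableSet_Ioo] with x hx
    rw [norm_mul]
    exact mul_le_mul (hbd x hx) (hbd x hx) (norm_nonneg _) ((norm_nonneg _).trans (hbd x hx))

/-- The sharp bound for the Chebyshev functional of a positive convex function. -/
theorem ConvexOn.chebyshevFunctional_le {b p q : ℝ} (hb : 0 < b) (hpq : p.HolderConjugate q)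
    {f : ℝ → ℝ} (hpos : ∀ x ∈ Set.Icc 0 b, 0 < f x) (hf : ConvexOn ℝ (Set.Icc 0 b) f) :
    ENNReal.ofReal |chebyshevFunctional 0 b f f| ≤
      ENNReal.ofReal (hardyConst b p q) * derivNorm b p f * derivNorm b q f := by
  obtain ⟨hi, hii⟩ := hf.intervalIntegrable_of_pos hb hpos
  have hf' : ConvexOn ℝ (Set.Ioo 0 b) f := hf.subset Set.Ioo_subset_Icc_self (convex_Ioo _ _)
  have hb2 : 0 < b / 2 := by linarith
  set c := f (b / 2) with hc
  have hlp := mixedEigenvalue_pos hpq.lt hb2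
  have hlq := mixedEigenvalue_pos hpq.symm.lt hb2
  have hP := ENNReal.rpow_inv_le_of_ofReal_mul_le hlp hpq.pos
    (hf'.lintegral_sub_midpoint_le hpq hb)
  have hQ := ENNReal.rpow_inv_le_of_ofReal_mul_le hlq hpq.symm.pos
    (hf'.lintegral_sub_midpoint_le hpq.symm hb)
  rw [← derivNorm_eq hpq.pos] at hP
  rw [← derivNorm_eq hpq.symm.pos] at hQ
  have hm : AEMeasurable (fun x => ‖f x - c‖ₑ) (volume.restrict (Set.Ioo 0 b)) := by
    have : AEMeasurable f (volume.restrict (Set.Ioo 0 b)) :=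
      (hf'.continuousOn isOpen_Ioo).aemeasurable measurableSet_Ioo
    fun_prop
  -- The same function enters both factors, once in `L^p` and once in `L^q`.
  have hH := ENNReal.lintegral_mul_le_Lp_mul_Lq (volume.restrict (Set.Ioo 0 b)) hpq hm hm
  have hint : IntegrableOn (fun t => (f t - c) * (f t - c)) (Set.Ioo 0 b) := by
    rw [← intervalIntegrable_iff_integrableOn_Ioo_of_le hb.le]
    have : (fun t => (f t - c) * (f t - c)) = fun t => f t * f t - 2 * c * f t + c ^ 2 := by
      ext t; ring
    rw [this]
    exact (hii.sub (hi.const_mul _)).add (by simp)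
  have hconv : ENNReal.ofReal (∫ t in (0 : ℝ)..b, (f t - c) * (f t - c)) =
      ∫⁻ x in Set.Ioo 0 b, ((fun x => ‖f x - c‖ₑ) * fun x => ‖f x - c‖ₑ) x := by
    rw [intervalIntegral.integral_of_le hb.le, integral_Ioc_eq_integral_Ioo,
      ofReal_integral_eq_lintegral_ofReal hint
        (Filter.Eventually.of_forall fun x => mul_self_nonneg _)]
    refine lintegral_congr fun x => ?_
    rw [Pi.mul_apply, ← enorm_mul, Real.enorm_of_nonneg (mul_self_nonneg _)]
  calc ENNReal.ofReal |chebyshevFunctional 0 b f f|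
      ≤ ENNReal.ofReal (1 / b * ∫ t in (0 : ℝ)..b, (f t - c) * (f t - c)) :=
        ENNReal.ofReal_le_ofReal (abs_chebyshevFunctional_self_le hb hi hii c)
    _ = ENNReal.ofReal (1 / b) *
        ENNReal.ofReal (∫ t in (0 : ℝ)..b, (f t - c) * (f t - c)) :=
        ENNReal.ofReal_mul (by positivity)
    _ ≤ ENNReal.ofReal (1 / b) *
        ((ENNReal.ofReal (mixedEigenvalue p (b / 2) ^ (1 / p))⁻¹ * derivNorm b p f) *
        (ENNReal.ofReal (mixedEigenvalue q (b / 2) ^ (1 / q))⁻¹ * derivNorm b q f)) := by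
        rw [hconv]
        gcongr
        exact hH.trans (mul_le_mul' hP hQ)
    _ = _ := by
        rw [hardyConst_eq hb hpq.lt hpq.symm.lt, ENNReal.ofReal_mul (by positivity),
          ENNReal.ofReal_mul (by positivity)]
        ring

theorem hardyFunctional_eq_chebyshevFunctional {b : ℝ} (hb : 0 < b) {f φ : ℝ → ℝ}
    (h : ∀ x ∈ Set.Ioo 0 b, f x = hardyAverage φ x) :
    hardyFunctional b φ = chebyshevFunctional 0 b f f := by
  have e : ∀ F : ℝ → ℝ, ∫ x in (0 : ℝ)..b, F (hardyAverage φ x) = ∫ x in (0 : ℝ)..b, F (f x) := by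
    intro F
    rw [intervalIntegral.integral_of_le hb.le, intervalIntegral.integral_of_le hb.le,
      integral_Ioc_eq_integral_Ioo, integral_Ioc_eq_integral_Ioo]
    exact setIntegral_congr_fun measurableSet_Ioo fun x hx => by simp only [h x hx]
  rw [hardyFunctional, chebyshevFunctional, e fun y => y ^ 2, e fun y => y]
  simp only [sub_zero, sq]

theorem mainTheorem12 (b p q : ℝ) (hb : 0 < b) (hp : 1 < p) (hq : 1 < q)
    (hpq : 1 / p + 1 / q = 1) (Φ : ℝ → ℝ)
    (hpos : ∀ x ∈ Set.Icc 0 b, 0 < Φ x)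
    (hconv : ConvexOn ℝ (Set.Icc 0 b) Φ)
    (hderiv : MemLp (deriv Φ) (ENNReal.ofReal p) (volume.restrict (Set.Icc 0 b))) :
    IntervalIntegrable Φ volume 0 b ∧
    IntervalIntegrable (fun t => Φ t * Φ t) volume 0 b ∧
    ENNReal.ofReal |chebyshevFunctional 0 b Φ Φ|
      ≤ ENNReal.ofReal (hardyConst b p q) * derivNorm b p Φ * derivNorm b q Φ ∧
    ∀ φ : ℝ → ℝ, IntervalIntegrable φ volume 0 b → (∀ t ∈ Set.Icc 0 b, 0 ≤ φ t) →
      (∀ x ∈ Set.Ioo 0 b, Φ x = hardyAverage φ x) →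
      ENNReal.ofReal |hardyFunctional b φ|
        ≤ ENNReal.ofReal (hardyConst b p q) * derivNorm b p Φ * derivNorm b q Φ := by
  have hconj : p.HolderConjugate q :=
    Real.holderConjugate_iff.2 ⟨hp, by simpa only [one_div] using hpq⟩
  have hle := hconv.chebyshevFunctional_le hb hconj hpos
  obtain ⟨hi, hii⟩ := hconv.intervalIntegrable_of_pos hb hpos
  refine ⟨hi, hii, hle, fun φ _ _ hφ => ?_⟩
  rwa [hardyFunctional_eq_chebyshevFunctional hb hφ]
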